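/- Let $(\Omega,\mathcal A,P)$ be a complete probability space, $I\subset\mathbb R$ a nonempty open interval (possibly unbounded), $g\in L^1(I)$, and let $\varphi\colon I\times\Omega\to I$ be such that $\varphi(\cdot,\omega)$ is a diffeomorphism of $I$ onto $I$ (a differentiable bijection with differentiable inverse) for every $\omega\in\Omega$, $\varphi(x,\cdot)$ is $\mathcal A$-measurable for every $x\in I$, and $(\lambda\otimes P)(\varphi^{-1}(B))=0$ for every Borel set $B\subset I$ with Lebesgue measure $\lambda(B)=0$. Fix $x_0\in I$ and put $\Omega_{+}=\{\omega:\varphi'_x(x_0,\omega)>0\}$, $\Omega_{-}=\{\omega:\varphi'_x(x_0,\omega)<0\}$ (these sets do not depend on $x_0$) and $G(x)=\int_{\inf I}^x g(t)\,dt$ for $x\in I$. For $\alpha\in\mathbb R$ consider the equations $$f(x)=\int_\Omega|\varphi'_x(x,\omega)|\,f(\varphi(x,\omega))\,P(d\omega)+g(x),\qquad(\mathrm e)$$ $$F(x)=\int_{\Omega_+}F(\varphi(x,\omega))\,P(d\omega)+\int_{\Omega_-}[\alpha-F(\varphi(x,\omega))]\,P(d\omega)+G(x)\quad\text{for every }x\in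 I.\qquad(\mathrm{e1})$$ An $L^1(I)$-solution of (e) is an $f\in L^1(I)$ every representative of which satisfies (e) for almost all $x\in I$. Assume $P(\Omega_+)=1$ and that, for some $l\in(0,1)$, $$\int_\Omega|\varphi(x,\omega)-\varphi(y,\omega)|\,P(d\omega)\le l|x-y|\quad\text{and}\quad\int_\Omega|\varphi(x,\omega)-x|\,P(d\omega)<\infty\qquad\text{for all }x,y\in I.$$ Let $\varphi_0\colon\operatorname{cl}I\times\Omega\to\operatorname{cl}I$ be the extension of $\varphi$ given by $\varphi_0(x,\omega)=\lim_{y\to x,\,y\in I}\varphi(y,\omega)$ for $x\in\operatorname{cl}I\setminus I$ (where this limit is not finite, put $\varphi_0(x,\omega)=x$), and define on $\Omega^\infty$ the iterates $\varphi_0^1(x,\varpi)=\varphi_0(x,\omega_1)$, $\varphi_0^{n+1}(x,\varpi)=\varphi_0(\varphi_0^n(x,\varpi),\omega_{n+1})$ for $\varpi=(\omega_1,\omega_2,\dots)$. Then there is exactly one probability distribution $\pi$ on $\operatorname{cl}I$ such that for every $x\in\operatorname{cl}I$ the distributions of $\varphi_0^n(x,\cdot)$ under $P^\infty$ converge weakly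 to $\pi$ as $n\to\infty$. Let $D(t)=\pi(\operatorname{cl}I\cap(-\infty,t])$ be its distribution function. If $$\int_I g(t)(1-D(t))\,dt=0$$ and there is $L\in(0,\infty)$ with $\left|\int_x^y g(t)\,dt\right|\le L|x-y|$ for all $x,y\in I$, then there is an absolutely continuous function $F\colon I\to\mathbb R$ which solves (e1); since $P(\Omega_-)=0$, it does so for every $\alpha$. Moreover, if $F\colon I\to\mathbb R$ is a solution of (e1) (with any $\alpha$) and $f\in L^1(I)$ satisfies $F(x)=\int_{\inf I}^x f(t)\,dt$ for every $x\in I$, then $f$ is an $L^1(I)$-solution of (e). -/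

import Mathlib

open MeasureTheory ProbabilityTheory Set Filter Topology

namespace RefinementEq

noncomputable section

/-- `h` restricts to a diffeomorphism of `I` onto `I`: a differentiable bijection of `I` whose
inverse is differentiable on `I`. The values of `h` outside `I` play no role when `I` is open. -/
def IsDiffeoOn (h : ℝ → ℝ) (I : Set ℝ) : Prop :=
  BijOn h I I ∧ DifferentiableOn ℝ h I ∧
    ∃ k : ℝ → ℝ, InvOn k h I I ∧ DifferentiableOn ℝ k I

/-- The standing conditions on `φ : I × Ω → I`. -/
structure IsAdmissible {Ω : Type*} [MeasurableSpace Ω] (P : Measure Ω) (I : Set ℝ)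
    (φ : ℝ → Ω → ℝ) : Prop where
  diffeo : ∀ ω, IsDiffeoOn (fun x => φ x ω) I
  measurable : ∀ x ∈ I, Measurable (φ x)
  null_preimage : ∀ B : Set ℝ, MeasurableSet B → B ⊆ I → volume B = 0 →
    ((volume : Measure ℝ).prod P) {p : ℝ × Ω | p.1 ∈ I ∧ φ p.1 p.2 ∈ B} = 0

/-- `Ω₊`, the set of `ω` with `φ'ₓ(x₀, ω) > 0`. -/
def omegaPlus {Ω : Type*} (φ : ℝ → Ω → ℝ) (x₀ : ℝ) : Set Ω :=
  {ω | 0 < deriv (fun x => φ x ω) x₀}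

/-- `Ω₋`, the set of `ω` with `φ'ₓ(x₀, ω) < 0`. -/
def omegaMinus {Ω : Type*} (φ : ℝ → Ω → ℝ) (x₀ : ℝ) : Set Ω :=
  {ω | deriv (fun x => φ x ω) x₀ < 0}

open Classical in
/-- The extension `φ₀` of `φ` to the closure of `I`, by `φ₀(x, ω) = lim_{y → x, y ∈ I} φ(y, ω)` at a
finite end point `x` of `I`. If this limit is not finite, the value is set to `x`, so that
`φ₀` keeps its values in the closure of `I`; under the mean contraction condition this happens
only for `ω` in a set of probability zero. -/
def extendClosure {Ω : Type*} (I : Set ℝ) (φ : ℝ → Ω → ℝ) (x : ℝ) (ω : Ω) : ℝ :=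
  if x ∈ I then φ x ω
  else if ∃ y : ℝ, Tendsto (fun z => φ z ω) (𝓝[I] x) (𝓝 y) then
    limUnder (𝓝[I] x) (fun z => φ z ω)
  else x

/-- Iterates of a random-valued function:
`ψⁿ⁺¹(x, (ω₀, ω₁, …)) = ψ(ψⁿ(x, (ω₀, ω₁, …)), ωₙ)`, starting from `ψ⁰(x, ·) = x`. -/
def rvIter {Ω : Type*} (ψ : ℝ → Ω → ℝ) : ℕ → ℝ → (ℕ → Ω) → ℝ
  | 0, x, _ => x
  | n + 1, x, ϖ => ψ (rvIter ψ n x ϖ) (ϖ n)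

/-- `π` is a probability distribution on the closure of `I` such that, for every `x` in the closure
of `I`, the distributions of `φ₀ⁿ(x, ·)` under `P^∞` converge weakly to `π`. -/
def IsLimitLaw {Ω : Type*} [MeasurableSpace Ω] (P : Measure Ω) [IsProbabilityMeasure P]
    (I : Set ℝ) (φ : ℝ → Ω → ℝ) (π : ProbabilityMeasure ℝ) : Prop :=
  (π : Measure ℝ) (closure I)ᶜ = 0 ∧
    ∀ x ∈ closure I, TendstoInDistribution (fun (n : ℕ) ϖ => rvIter (extendClosure I φ) n x ϖ) atTop id
      (fun _ => Measure.infinitePi (fun _ : ℕ => P)) (π : Measure ℝ)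

/-- Absolute continuity of `F` on an interval `I`, bounded or not. -/
def AbsContOn (F : ℝ → ℝ) (I : Set ℝ) : Prop :=
  ∀ ε > 0, ∃ δ > 0, ∀ (n : ℕ) (a b : Fin n → ℝ),
    (∀ i, a i ∈ I ∧ b i ∈ I ∧ a i ≤ b i) →
    Pairwise (fun i j => Disjoint (Ioo (a i) (b i)) (Ioo (a j) (b j))) →
    ∑ i, (b i - a i) < δ → ∑ i, |F (b i) - F (a i)| < ε

/-- The function `x ↦ ∫_{inf I}^x g(t) dt` on the interval `I`. -/
def primitive (I : Set ℝ) (g : ℝ → ℝ) (x : ℝ) : ℝ :=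
  ∫ t in I ∩ Iic x, g t

/-- `F` satisfies, for every `x ∈ I`,
`F(x) = ∫_{Ω₊} F(φ(x,ω)) dP + ∫_{Ω₋} [α - F(φ(x,ω))] dP + ∫_{inf I}^x g(t) dt`,
where both integrals over `Ω` exist. -/
def SolvesPrimitiveEq {Ω : Type*} [MeasurableSpace Ω] (P : Measure Ω) (I : Set ℝ)
    (φ : ℝ → Ω → ℝ) (g : ℝ → ℝ) (x₀ α : ℝ) (F : ℝ → ℝ) : Prop :=
  ∀ x ∈ I,
    IntegrableOn (fun ω => F (φ x ω)) (omegaPlus φ x₀) P ∧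
    IntegrableOn (fun ω => α - F (φ x ω)) (omegaMinus φ x₀) P ∧
    F x = (∫ ω in omegaPlus φ x₀, F (φ x ω) ∂P) + (∫ ω in omegaMinus φ x₀, (α - F (φ x ω)) ∂P)
      + primitive I g x

/-- `f` is an `L¹(I)`-solution of `f(x) = ∫_Ω |φ'ₓ(x,ω)| f(φ(x,ω)) dP + g(x)`: it is integrable on
`I`, and every representative of `f` satisfies the equation (with existing integral) for almost all
`x ∈ I`. -/
def IsL1Solution {Ω : Type*} [MeasurableSpace Ω] (P : Measure Ω) (I : Set ℝ)
    (φ : ℝ → Ω → ℝ) (g f : ℝ → ℝ) : Prop :=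
  IntegrableOn f I ∧
    ∀ f' : ℝ → ℝ, f' =ᵐ[volume.restrict I] f →
      ∀ᵐ x ∂(volume.restrict I),
        Integrable (fun ω => |deriv (fun y => φ y ω) x| * f' (φ x ω)) P ∧
        f' x = (∫ ω, |deriv (fun y => φ y ω) x| * f' (φ x ω) ∂P) + g x

end

end RefinementEq

open RefinementEq

/-! Existence. Almost surely `φ(·, ω)` is an increasing bijection of `I`, so it fixes every finite
end point. Thus `φ₀` agrees almost surely with `baseMap`, and the mean contraction extends to
`closure I` by Fatou (`IsAdmissible.meanContraction`). Let `T h y = ∫ h(ψ(y, ω)) dP`. It multiplies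
Lipschitz constants by `l`, so for bounded Lipschitz `h` the functions `T^n h` converge pointwise,
with geometrically small increments, to a constant. Since `T^n h x` is the mean of `h` under the law
of the `n`-th iterate (`BddLipOn.integral_iterLaw`), and those laws are tight, Prokhorov's theorem
yields the limit `π` (`MeanContraction.exists_limitLaw`).

The primitive `G` of `g` is bounded because `g` is integrable, and Lipschitz by assumption. By
Fubini `∫ G dπ = ∫ g (1 - D) = 0`, so `T^n G → 0` geometrically. The Neumann series `F = ∑ T^n G`
then satisfies `F = T F + G` and is Lipschitz, hence absolutely continuous
(`BddLipOn.exists_lipschitz_solution`).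

Converse. If the primitive of `f` solves the integrated equation, a change of variables for each `ω`
followed by Fubini shows that both sides of (e) have equal integrals over all subintervals of `I`.
They therefore agree almost everywhere by Lebesgue differentiation
(`IsAdmissible.ae_eq_of_primitive_solution`). -/

namespace RefinementEq

/-! ### Iterates of random maps and their laws -/

section Iterates

variable {Ω : Type*}

lemma rvIter_mem {ψ : ℝ → Ω → ℝ} {J : Set ℝ} (hψ : ∀ x ∈ J, ∀ ω, ψ x ω ∈ J) {x : ℝ} (hx : x ∈ J)
    (n : ℕ) (ϖ : ℕ → Ω) : rvIter ψ n x ϖ ∈ J := by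
  induction n with
  | zero => exact hx
  | succ n ih => exact hψ _ ih _

lemma rvIter_congr_noise (ψ : ℝ → Ω → ℝ) (x : ℝ) {n : ℕ} {ϖ ϖ' : ℕ → Ω}
    (h : ∀ i < n, ϖ i = ϖ' i) : rvIter ψ n x ϖ = rvIter ψ n x ϖ' := by
  induction n with
  | zero => rfl
  | succ n ih =>
    simp only [rvIter]
    rw [ih fun i hi => h i (hi.trans n.lt_succ_self), h n n.lt_succ_self]

variable [MeasurableSpace Ω]

lemma measurable_rvIter {ψ : ℝ → Ω → ℝ} (hψ : Measurable (Function.uncurry ψ)) (x : ℝ) (n : ℕ) :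
    Measurable (rvIter ψ n x) := by
  induction n with
  | zero => exact measurable_const
  | succ n ih => exact hψ.comp (ih.prodMk (measurable_pi_apply n))

variable (P : Measure Ω)

/-- The law of the `n`-th iterate started at `x`. -/
noncomputable def iterLaw (ψ : ℝ → Ω → ℝ) (n : ℕ) (x : ℝ) : Measure ℝ :=
  (Measure.infinitePi fun _ : ℕ => P).map (rvIter ψ n x)

lemma ae_iterLaw_mem {ψ : ℝ → Ω → ℝ} (hψ : Measurable (Function.uncurry ψ)) {J : Set ℝ}
    (hJ : MeasurableSet J) (hmap : ∀ x ∈ J, ∀ ω, ψ x ω ∈ J) (n : ℕ) {x : ℝ} (hx : x ∈ J) :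
    ∀ᵐ y ∂iterLaw P ψ n x, y ∈ J := by
  refine (ae_map_iff (measurable_rvIter hψ x n).aemeasurable hJ).2 ?_
  exact ae_of_all _ fun ϖ => rvIter_mem hmap hx n ϖ

variable [IsProbabilityMeasure P]

/-- The position after `n` steps is independent of the next noise term. -/
lemma indepFun_rvIter {ψ : ℝ → Ω → ℝ} (hψ : Measurable (Function.uncurry ψ)) (x : ℝ) (n : ℕ) :
    IndepFun (rvIter ψ n x) (fun ϖ : ℕ → Ω => ϖ n) (Measure.infinitePi fun _ : ℕ => P) := by
  classical
  obtain ⟨ω₀⟩ : Nonempty Ω := P.nonempty_of_neZero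
  have hind := iIndepFun_infinitePi (P := fun _ : ℕ => P) (X := fun _ ω => ω)
    (fun _ => measurable_id)
  have h := hind.indepFun_finset (Finset.range n) {n} (by simp) (fun i => measurable_pi_apply i)
  -- The `n`-th iterate only sees the first `n` coordinates, so it factors through `e`; the padding
  -- value `ω₀` is irrelevant.
  let e : (Finset.range n → Ω) → ℕ → Ω := fun v i =>
    if h : i ∈ Finset.range n then v ⟨i, h⟩ else ω₀
  have he : Measurable e := by
    refine measurable_pi_lambda _ fun i => ?_
    by_cases h : i ∈ Finset.range n
    · simpa only [e, h, dite_true] using measurable_pi_apply _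
    · simp only [e, h, dite_false, measurable_const]
  have h2 := h.comp ((measurable_rvIter hψ x n).comp he)
    (measurable_pi_apply (⟨n, by simp⟩ : ({n} : Finset ℕ)))
  have h3 : rvIter ψ n x = (rvIter ψ n x ∘ e) ∘ fun ϖ (i : Finset.range n) => ϖ i := by
    funext ϖ
    refine rvIter_congr_noise ψ x fun i hi => ?_
    simp [e, hi]
  rw [h3]
  exact h2

lemma isProbabilityMeasure_iterLaw {ψ : ℝ → Ω → ℝ} (hψ : Measurable (Function.uncurry ψ))
    (n : ℕ) (x : ℝ) : IsProbabilityMeasure (iterLaw P ψ n x) :=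
  Measure.isProbabilityMeasure_map (measurable_rvIter hψ x n).aemeasurable

/-- Independence of the current position and the next noise turns their joint law into a product;
this is the Markov property. -/
lemma iterLaw_succ {ψ : ℝ → Ω → ℝ} (hψ : Measurable (Function.uncurry ψ)) (n : ℕ) (x : ℝ) :
    iterLaw P ψ (n + 1) x = ((iterLaw P ψ n x).prod P).map (Function.uncurry ψ) := by
  have h := (indepFun_rvIter P hψ x n).map_prod_eq_prod_map_map
    (measurable_rvIter hψ x n).aemeasurable (measurable_pi_apply n).aemeasurable
  rw [Measure.infinitePi_map_eval] at h
  rw [iterLaw, iterLaw, ← h, Measure.map_map hψ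
    ((measurable_rvIter hψ x n).prodMk (measurable_pi_apply n))]
  rfl

end Iterates

/-! ### Mean contractions: Markov operator, tightness, limit law -/

section Transfer

variable {Ω : Type*} [MeasurableSpace Ω]

/-- The Markov operator `h ↦ ∫ h(ψ(·, ω)) dP`. -/
noncomputable def markovOp (P : Measure Ω) (ψ : ℝ → Ω → ℝ) (h : ℝ → ℝ) (y : ℝ) : ℝ :=
  ∫ ω, h (ψ y ω) ∂P

/-- Bounded measurable functions which are `K`-Lipschitz on `J`. -/
structure BddLipOn (J : Set ℝ) (K : ℝ) (h : ℝ → ℝ) : Prop where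
  measurable : Measurable h
  lip : ∀ x ∈ J, ∀ y ∈ J, |h x - h y| ≤ K * |x - y|
  bdd : ∃ C, ∀ x, |h x| ≤ C

/-- A jointly measurable random map preserving `J`, which contracts in the mean on `J` and has
finite mean displacement. -/
structure MeanContraction (P : Measure Ω) (J : Set ℝ) (l : ℝ) (ψ : ℝ → Ω → ℝ) : Prop where
  measurable : Measurable (Function.uncurry ψ)
  mapsTo : ∀ x ∈ J, ∀ ω, ψ x ω ∈ J
  contr : ∀ x ∈ J, ∀ y ∈ J,
    ∫⁻ ω, ENNReal.ofReal |ψ x ω - ψ y ω| ∂P ≤ ENNReal.ofReal (l * |x - y|)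
  moment : ∀ x ∈ J, ∫⁻ ω, ENNReal.ofReal |ψ x ω - x| ∂P < ⊤
  pos : 0 < l
  lt_one : l < 1

variable {P : Measure Ω} {J : Set ℝ} {l K : ℝ} {ψ : ℝ → Ω → ℝ}
  {h : ℝ → ℝ}

lemma MeanContraction.measurable_apply (H : MeanContraction P J l ψ) (x : ℝ) :
    Measurable (ψ x) := H.measurable.comp measurable_prodMk_left

lemma MeanContraction.integrable_sub (H : MeanContraction P J l ψ) {x y : ℝ} (hx : x ∈ J)
    (hy : y ∈ J) : Integrable (fun ω => |ψ x ω - ψ y ω|) P := by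
  refine ⟨((H.measurable_apply x).sub (H.measurable_apply y)).abs.aestronglyMeasurable, ?_⟩
  rw [hasFiniteIntegral_iff_ofReal (ae_of_all _ fun _ => abs_nonneg _)]
  exact (H.contr x hx y hy).trans_lt ENNReal.ofReal_lt_top

lemma MeanContraction.integral_sub_le (H : MeanContraction P J l ψ) {x y : ℝ} (hx : x ∈ J)
    (hy : y ∈ J) : ∫ ω, |ψ x ω - ψ y ω| ∂P ≤ l * |x - y| := by
  rw [integral_eq_lintegral_of_nonneg_ae (ae_of_all _ fun _ => abs_nonneg _)
    (H.integrable_sub hx hy).1]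
  exact ENNReal.toReal_le_of_le_ofReal (mul_nonneg H.pos.le (abs_nonneg _)) (H.contr x hx y hy)

lemma MeanContraction.integrable_disp (H : MeanContraction P J l ψ) {x : ℝ} (hx : x ∈ J) :
    Integrable (fun ω => |ψ x ω - x|) P := by
  refine ⟨((H.measurable_apply x).sub measurable_const).abs.aestronglyMeasurable, ?_⟩
  rw [hasFiniteIntegral_iff_ofReal (ae_of_all _ fun _ => abs_nonneg _)]
  exact H.moment x hx

variable [IsProbabilityMeasure P]

lemma BddLipOn.integrable_comp (H : MeanContraction P J l ψ) (hh : BddLipOn J K h) (x : ℝ) :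
    Integrable (fun ω => h (ψ x ω)) P := by
  obtain ⟨C, hC⟩ := hh.bdd
  exact Integrable.of_bound (hh.measurable.comp (H.measurable_apply x)).aestronglyMeasurable C
    (ae_of_all _ fun ω => hC _)

/-- Integrating the Lipschitz bound for `h` and applying mean contraction gains the factor `l`,
which drives all later geometric estimates. -/
lemma BddLipOn.map_markovOp (hK : 0 ≤ K) (H : MeanContraction P J l ψ) (hh : BddLipOn J K h) :
    BddLipOn J (K * l) (markovOp P ψ h) := by
  refine ⟨?_, fun x hx y hy => ?_, ?_⟩
  · exact (StronglyMeasurable.integral_prod_right (f := fun y ω => h (ψ y ω))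
      (hh.measurable.comp H.measurable).stronglyMeasurable).measurable
  · simp only [markovOp]
    rw [← integral_sub (hh.integrable_comp H x) (hh.integrable_comp H y)]
    calc |∫ ω, (h (ψ x ω) - h (ψ y ω)) ∂P| ≤ ∫ ω, |h (ψ x ω) - h (ψ y ω)| ∂P :=
          abs_integral_le_integral_abs
      _ ≤ ∫ ω, K * |ψ x ω - ψ y ω| ∂P := integral_mono
          ((hh.integrable_comp H x).sub (hh.integrable_comp H y)).abs
          ((H.integrable_sub hx hy).const_mul K)
          fun ω => hh.lip _ (H.mapsTo x hx ω) _ (H.mapsTo y hy ω)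
      _ ≤ K * l * |x - y| := by
          rw [integral_const_mul, mul_assoc]
          exact mul_le_mul_of_nonneg_left (H.integral_sub_le hx hy) hK
  · obtain ⟨C, hC⟩ := hh.bdd
    refine ⟨C, fun x => ?_⟩
    have := norm_integral_le_of_norm_le_const (μ := P) (f := fun ω => h (ψ x ω)) (C := C)
      (ae_of_all _ fun ω => hC _)
    simpa [markovOp] using this

lemma BddLipOn.map_markovOp_iterate (hK : 0 ≤ K) (H : MeanContraction P J l ψ) (hh : BddLipOn J K h)
    (n : ℕ) : BddLipOn J (K * l ^ n) ((markovOp P ψ)^[n] h) := by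
  induction n with
  | zero => simpa using hh
  | succ n ih =>
    rw [Function.iterate_succ_apply', pow_succ, ← mul_assoc]
    exact ih.map_markovOp (mul_nonneg hK (pow_nonneg H.pos.le n)) H

lemma BddLipOn.abs_markovOp_sub_le (H : MeanContraction P J l ψ)
    (hh : BddLipOn J K h) {x : ℝ} (hx : x ∈ J) :
    |markovOp P ψ h x - h x| ≤ K * ∫ ω, |ψ x ω - x| ∂P := by
  have h1 : markovOp P ψ h x - h x = ∫ ω, (h (ψ x ω) - h x) ∂P := by
    rw [integral_sub (hh.integrable_comp H x) (integrable_const _)]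
    simp [markovOp]
  rw [h1, ← integral_const_mul]
  refine abs_integral_le_integral_abs.trans (integral_mono
    ((hh.integrable_comp H x).sub (integrable_const _)).abs
    ((H.integrable_disp hx).const_mul K) fun ω => hh.lip _ (H.mapsTo x hx ω) _ hx)

lemma BddLipOn.dist_markovOp_iterate_le (hK : 0 ≤ K) (H : MeanContraction P J l ψ)
    (hh : BddLipOn J K h) {x : ℝ} (hx : x ∈ J) (n : ℕ) :
    dist ((markovOp P ψ)^[n] h x) ((markovOp P ψ)^[n + 1] h x)
      ≤ (K * ∫ ω, |ψ x ω - x| ∂P) * l ^ n := by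
  rw [Function.iterate_succ_apply', dist_comm, Real.dist_eq]
  refine ((hh.map_markovOp_iterate hK H n).abs_markovOp_sub_le H hx).trans_eq (by ring)

/-- Duality between laws and the Markov operator. The induction varies `h` and `K`, since the last
step of the chain becomes the first operator applied to `h`. -/
lemma BddLipOn.integral_iterLaw (hK : 0 ≤ K) (H : MeanContraction P J l ψ)
    (hh : BddLipOn J K h) (n : ℕ) (x : ℝ) :
    ∫ y, h y ∂iterLaw P ψ n x = (markovOp P ψ)^[n] h x := by
  induction n generalizing h K with
  | zero =>
    have h0 : rvIter ψ 0 x = fun _ => x := rfl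
    simp [iterLaw, h0, Measure.map_const]
  | succ n ih =>
    have := isProbabilityMeasure_iterLaw P H.measurable n x
    obtain ⟨C, hC⟩ := hh.bdd
    rw [Function.iterate_succ_apply, ← ih (mul_nonneg hK H.pos.le) (hh.map_markovOp hK H),
      iterLaw_succ P H.measurable, integral_map H.measurable.aemeasurable
        hh.measurable.aestronglyMeasurable, integral_prod]
    · rfl
    · exact Integrable.of_bound (hh.measurable.comp H.measurable).aestronglyMeasurable C
        (ae_of_all _ fun ω => hC _)

/-- At one point the increments are geometric, so the sequence is Cauchy; the Lipschitz constants `K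
* l ^ n` tend to zero, so all points share its limit. -/
lemma BddLipOn.exists_tendsto_markovOp_iterate (hK : 0 ≤ K) (H : MeanContraction P J l ψ)
    (hh : BddLipOn J K h) {x₀ : ℝ} (hx₀ : x₀ ∈ J) :
    ∃ c, ∀ x ∈ J, Tendsto (fun n => (markovOp P ψ)^[n] h x) atTop (𝓝 c) := by
  obtain ⟨c, hc⟩ := cauchySeq_tendsto_of_complete
    (cauchySeq_of_le_geometric l _ H.lt_one (hh.dist_markovOp_iterate_le hK H hx₀))
  refine ⟨c, fun x hx => ?_⟩
  have h0 : Tendsto (fun n : ℕ => K * l ^ n * |x - x₀|) atTop (𝓝 0) := by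
    simpa using ((tendsto_pow_atTop_nhds_zero_of_lt_one H.pos.le H.lt_one).const_mul K).mul_const
      |x - x₀|
  have h1 := squeeze_zero_norm (f := fun n => (markovOp P ψ)^[n] h x - (markovOp P ψ)^[n] h x₀)
    (fun n => (hh.map_markovOp_iterate hK H n).lip x hx x₀ hx₀) h0
  simpa using h1.add hc

/-- The iterates have bounded mean displacement. -/
lemma MeanContraction.exists_lintegral_disp_le (H : MeanContraction P J l ψ)
    (hJ : MeasurableSet J) {x : ℝ} (hx : x ∈ J) :
    ∃ B : ℝ, 0 < B ∧ ∀ n, ∫⁻ y, ENNReal.ofReal |y - x| ∂iterLaw P ψ n x ≤ ENNReal.ofReal B := by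
  set M := ∫ ω, |ψ x ω - x| ∂P with hM
  have hM0 : 0 ≤ M := integral_nonneg fun _ => abs_nonneg _
  have hl := sub_pos.2 H.lt_one
  -- The mean displacement obeys `d (n + 1) ≤ l * d n + M`, which preserves the bound `M / (1 - l)`;
  -- the extra `1` makes the bound strictly positive even when `M = 0`.
  have hB : 0 < (M + 1) / (1 - l) := by positivity
  refine ⟨(M + 1) / (1 - l), hB, fun n => ?_⟩
  have hmeas : Measurable fun y : ℝ => ENNReal.ofReal |y - x| := by fun_prop
  induction n with
  | zero =>
    have h0 : rvIter ψ 0 x = fun _ => x := rfl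
    simp [iterLaw, h0, Measure.map_const, lintegral_dirac' _ hmeas]
  | succ n ih =>
    have := isProbabilityMeasure_iterLaw P H.measurable n x
    rw [iterLaw_succ P H.measurable, lintegral_map hmeas H.measurable,
      lintegral_prod (fun p : ℝ × Ω => ENNReal.ofReal |Function.uncurry ψ p - x|)
        (hmeas.comp H.measurable).aemeasurable]
    have hstep : ∀ᵐ y ∂iterLaw P ψ n x,
        ∫⁻ ω, ENNReal.ofReal |Function.uncurry ψ (y, ω) - x| ∂P
          ≤ ENNReal.ofReal l * ENNReal.ofReal |y - x| + ENNReal.ofReal M := by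
      filter_upwards [ae_iterLaw_mem P H.measurable hJ H.mapsTo n hx] with y hy
      calc ∫⁻ ω, ENNReal.ofReal |ψ y ω - x| ∂P
          ≤ ∫⁻ ω, (ENNReal.ofReal |ψ y ω - ψ x ω| + ENNReal.ofReal |ψ x ω - x|) ∂P := by
            refine lintegral_mono fun ω => ?_
            rw [← ENNReal.ofReal_add (abs_nonneg _) (abs_nonneg _)]
            exact ENNReal.ofReal_le_ofReal (abs_sub_le _ _ _)
        _ = ∫⁻ ω, ENNReal.ofReal |ψ y ω - ψ x ω| ∂P + ∫⁻ ω, ENNReal.ofReal |ψ x ω - x| ∂P :=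
            lintegral_add_left (((H.measurable_apply y).sub
              (H.measurable_apply x)).abs.ennreal_ofReal) _
        _ ≤ _ := by
            rw [← ENNReal.ofReal_mul H.pos.le, hM, ofReal_integral_eq_lintegral_ofReal
              (H.integrable_disp hx) (ae_of_all _ fun _ => abs_nonneg _)]
            gcongr
            exact H.contr y hy x hx
    refine (lintegral_mono_ae hstep).trans ?_
    rw [lintegral_add_right _ measurable_const, lintegral_const_mul _ hmeas, lintegral_const,
      measure_univ, mul_one]
    calc _ ≤ ENNReal.ofReal l * ENNReal.ofReal ((M + 1) / (1 - l)) + ENNReal.ofReal M := by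
          gcongr
      _ = ENNReal.ofReal (l * ((M + 1) / (1 - l)) + M) := by
          rw [← ENNReal.ofReal_mul H.pos.le,
            ← ENNReal.ofReal_add (mul_nonneg H.pos.le hB.le) hM0]
      _ ≤ _ := by
          refine ENNReal.ofReal_le_ofReal ?_
          have : (M + 1) / (1 - l) * (1 - l) = M + 1 := div_mul_cancel₀ _ hl.ne'
          nlinarith

/-- Markov's inequality applied to the uniform bound on the mean displacement; the radius `B / ε`
makes the tail at most `ε`. -/
lemma MeanContraction.isTightMeasureSet (H : MeanContraction P J l ψ) (hJ : MeasurableSet J)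
    {x : ℝ} (hx : x ∈ J) : IsTightMeasureSet (range fun n => iterLaw P ψ n x) := by
  obtain ⟨B, hB, hle⟩ := H.exists_lintegral_disp_le hJ hx
  rw [isTightMeasureSet_iff_exists_isCompact_measure_compl_le]
  intro ε hε
  by_cases hε' : ε = ⊤
  · exact ⟨∅, isCompact_empty, fun _ _ => by simp [hε']⟩
  set e := ε.toReal
  have he : 0 < e := ENNReal.toReal_pos hε.ne' hε'
  refine ⟨Metric.closedBall x (B / e), isCompact_closedBall _ _, ?_⟩
  rintro _ ⟨n, rfl⟩
  have hBe : 0 < B / e := by positivity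
  calc iterLaw P ψ n x (Metric.closedBall x (B / e))ᶜ
      ≤ iterLaw P ψ n x {y | ENNReal.ofReal (B / e) ≤ ENNReal.ofReal |y - x|} := by
        refine measure_mono fun y hy => ENNReal.ofReal_le_ofReal ?_
        simp only [Metric.mem_closedBall, mem_compl_iff, not_le, Real.dist_eq] at hy
        exact hy.le
    _ ≤ (∫⁻ y, ENNReal.ofReal |y - x| ∂iterLaw P ψ n x) / ENNReal.ofReal (B / e) :=
        meas_ge_le_lintegral_div (by fun_prop) (by simpa using hBe) ENNReal.ofReal_ne_top
    _ ≤ ENNReal.ofReal B / ENNReal.ofReal (B / e) := by gcongr; exact hle n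
    _ = ε := by
        rw [← ENNReal.ofReal_div_of_pos hBe, div_div_cancel₀ hB.ne', ENNReal.ofReal_toReal hε']

lemma bddLipOn_of_lipschitzWith {f : ℝ → ℝ} (hb : ∃ C : ℝ, ∀ x y, dist (f x) (f y) ≤ C)
    {L : NNReal} (hL : LipschitzWith L f) (J : Set ℝ) : BddLipOn J L f := by
  refine ⟨hL.continuous.measurable, fun x _ y _ => hL.dist_le_mul x y, ?_⟩
  obtain ⟨C, hC⟩ := hb
  refine ⟨C + |f 0|, fun x => ?_⟩
  have h1 := hC x 0
  rw [Real.dist_eq] at h1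
  have h2 := abs_add_le (f x - f 0) (f 0)
  rw [sub_add_cancel] at h2
  linarith

/-- The laws of the iterates of a mean contraction converge weakly to a limit which does not depend
on the starting point. -/
theorem MeanContraction.exists_limitLaw (H : MeanContraction P J l ψ) (hJ : IsClosed J)
    (hne : J.Nonempty) :
    ∃ π : ProbabilityMeasure ℝ, (π : Measure ℝ) Jᶜ = 0 ∧ ∀ x ∈ J,
      Tendsto (β := ProbabilityMeasure ℝ) (fun n => ⟨iterLaw P ψ n x,
        isProbabilityMeasure_iterLaw P H.measurable n x⟩) atTop (𝓝 π) := by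
  obtain ⟨x₀, hx₀⟩ := hne
  let μ : ℝ → ℕ → ProbabilityMeasure ℝ := fun x n =>
    ⟨iterLaw P ψ n x, isProbabilityMeasure_iterLaw P H.measurable n x⟩
  have hcomp : IsCompact (closure (range (μ x₀))) := by
    refine isCompact_closure_of_isTightMeasureSet
      ((H.isTightMeasureSet hJ.measurableSet hx₀).subset ?_)
    rintro _ ⟨_, ⟨n, rfl⟩, rfl⟩
    exact ⟨n, rfl⟩
  -- Tightness only supplies a cluster point. Each Lipschitz test integral converges, so its limit
  -- must be the value at `π`, which upgrades clustering to convergence.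
  obtain ⟨π, -, hπ⟩ := hcomp.exists_mapClusterPt (f := atTop) (u := μ x₀)
    (tendsto_principal.2 (Eventually.of_forall fun n => subset_closure ⟨n, rfl⟩))
  have hlim : ∀ x ∈ J, Tendsto (μ x) atTop (𝓝 π) := by
    intro x hx
    rw [tendsto_iff_forall_lipschitz_integral_tendsto]
    rintro f hb ⟨L, hL⟩
    have hf := bddLipOn_of_lipschitzWith hb hL J
    obtain ⟨c, hc⟩ := hf.exists_tendsto_markovOp_iterate L.2 H hx₀
    have hint : ∀ y ∈ J, Tendsto (fun n => ∫ z, f z ∂(μ y n : Measure ℝ)) atTop (𝓝 c) :=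
      fun y hy => (hc y hy).congr fun n => (hf.integral_iterLaw L.2 H n y).symm
    let f' : BoundedContinuousFunction ℝ ℝ := ⟨⟨f, hL.continuous⟩, hb⟩
    have hcont : Continuous fun ν : ProbabilityMeasure ℝ => ∫ z, f z ∂(ν : Measure ℝ) :=
      continuous_iff_continuousAt.2 fun ν =>
        (ProbabilityMeasure.tendsto_iff_forall_integral_tendsto.1 tendsto_id) f'
    have hcl := hπ.tendsto_comp (hcont.tendsto π)
    have heq : ∫ z, f z ∂(π : Measure ℝ) = c := by
      have : ClusterPt (∫ z, f z ∂(π : Measure ℝ)) (𝓝 c) := ClusterPt.mono hcl (hint x₀ hx₀)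
      exact eq_of_nhds_neBot this
    rw [heq]
    exact hint x hx
  refine ⟨π, ?_, hlim⟩
  -- Portmanteau on the open set `Jᶜ`, which is null for every iterate law.
  have h1 := ProbabilityMeasure.le_liminf_measure_open_of_tendsto (hlim x₀ hx₀) hJ.isOpen_compl
  have h2 : ∀ n, (μ x₀ n : Measure ℝ) Jᶜ = 0 := fun n =>
    ae_iterLaw_mem P H.measurable hJ.measurableSet H.mapsTo n hx₀
  simpa [h2] using h1

end Transfer

/-! ### Increasing diffeomorphisms of an interval -/

section Monotone

lemma IsDiffeoOn.strictMonoOn {h : ℝ → ℝ} {I : Set ℝ} (hd : IsDiffeoOn h I) (hI : IsOpen I)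
    (hc : I.OrdConnected) {x₀ : ℝ} (hx₀ : x₀ ∈ I) (hpos : 0 < deriv h x₀) :
    StrictMonoOn h I := by
  intro x hx y hy hxy
  -- A compact interval containing `x`, `y` and `x₀`: injectivity and continuity force monotonicity
  -- one way or the other there, and the derivative at `x₀` decides which.
  have hsub : Icc (min x x₀) (max y x₀) ⊆ I := by
    refine hc.out ?_ ?_
    · rcases min_choice x x₀ with h | h <;> rw [h] <;> assumption
    · rcases max_choice y x₀ with h | h <;> rw [h] <;> assumption
  have hlt : min x x₀ < max y x₀ := (min_le_left _ _).trans_lt (hxy.trans_le (le_max_left _ _))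
  have hx0' : x₀ ∈ Icc (min x x₀) (max y x₀) := ⟨min_le_right _ _, le_max_right _ _⟩
  rcases (hd.2.1.continuousOn.mono hsub).strictMonoOn_of_injOn_Icc' hlt.le
    (hd.1.injOn.mono hsub) with h | h
  · exact h ⟨min_le_left _ _, hxy.le.trans (le_max_left _ _)⟩
      ⟨(min_le_left _ _).trans hxy.le, le_max_left _ _⟩ hxy
  · have h1 := h.antitoneOn.derivWithin_nonpos (x := x₀)
    rw [((hd.2.1 x₀ hx₀).differentiableAt (hI.mem_nhds hx₀)).derivWithin
      (uniqueDiffOn_Icc hlt x₀ hx0')] at h1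
    exact absurd hpos h1.not_gt

/-- An increasing bijection of an interval tends to each finite end point at that end point. -/
lemma tendsto_endpoint_of_strictMonoOn {h : ℝ → ℝ} {I : Set ℝ} (hb : BijOn h I I)
    (hm : StrictMonoOn h I) (hc : I.OrdConnected) {x : ℝ} (hx : x ∈ closure I) (hxI : x ∉ I) :
    Tendsto h (𝓝[I] x) (𝓝 x) := by
  have key : (∀ u ∈ I, x < u) ∨ ∀ u ∈ I, u < x := by
    by_contra hcon
    push Not at hcon
    obtain ⟨⟨u, hu, hux⟩, v, hv, hvx⟩ := hcon
    exact hxI (hc.out hu hv ⟨hux, hvx⟩)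
  rw [tendsto_order]
  rcases key with key | key
  · refine ⟨fun a ha => ?_, fun a ha => ?_⟩
    · filter_upwards [self_mem_nhdsWithin] with u hu
      exact ha.trans (key _ (hb.mapsTo hu))
    · obtain ⟨z, hza, hz⟩ := mem_closure_iff_nhds.1 hx (Iio a) (Iio_mem_nhds ha)
      obtain ⟨w, hw, rfl⟩ := hb.surjOn hz
      filter_upwards [self_mem_nhdsWithin, mem_nhdsWithin_of_mem_nhds (Iio_mem_nhds (key w hw))]
        with u hu huw
      exact (hm hu hw huw).trans hza
  · refine ⟨fun a ha => ?_, fun a ha => ?_⟩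
    · obtain ⟨z, hza, hz⟩ := mem_closure_iff_nhds.1 hx (Ioi a) (Ioi_mem_nhds ha)
      obtain ⟨w, hw, rfl⟩ := hb.surjOn hz
      filter_upwards [self_mem_nhdsWithin, mem_nhdsWithin_of_mem_nhds (Ioi_mem_nhds (key w hw))]
        with u hu huw
      exact lt_trans hza (hm hw hu huw)
    · filter_upwards [self_mem_nhdsWithin] with u hu
      exact (key _ (hb.mapsTo hu)).trans ha

end Monotone

/-! ### Measurability of the random map and its extension to the closure -/

section BaseMap

variable {Ω : Type*}

open Classical in
/-- The map equal to `φ` on `I` and to the identity elsewhere. -/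
noncomputable def baseMap (I : Set ℝ) (φ : ℝ → Ω → ℝ) (x : ℝ) (ω : Ω) : ℝ :=
  if x ∈ I then φ x ω else x

lemma baseMap_of_mem {I : Set ℝ} {φ : ℝ → Ω → ℝ} {x : ℝ} (hx : x ∈ I) (ω : Ω) :
    baseMap I φ x ω = φ x ω := if_pos hx

lemma baseMap_of_notMem {I : Set ℝ} {φ : ℝ → Ω → ℝ} {x : ℝ} (hx : x ∉ I) (ω : Ω) :
    baseMap I φ x ω = x := if_neg hx

variable [MeasurableSpace Ω] {P : Measure Ω} {I : Set ℝ} {φ : ℝ → Ω → ℝ}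

lemma IsAdmissible.mem (hφ : IsAdmissible P I φ) {x : ℝ} (hx : x ∈ I) (ω : Ω) : φ x ω ∈ I :=
  (hφ.diffeo ω).1.mapsTo hx

lemma IsAdmissible.baseMap_mem_closure (hφ : IsAdmissible P I φ) {x : ℝ} (hx : x ∈ closure I)
    (ω : Ω) : baseMap I φ x ω ∈ closure I := by
  by_cases h : x ∈ I
  · rw [baseMap_of_mem h]
    exact subset_closure (hφ.mem h ω)
  · rwa [baseMap_of_notMem h]

lemma IsAdmissible.hasDerivAt (hφ : IsAdmissible P I φ) (hI : IsOpen I) {x : ℝ} (hx : x ∈ I)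
    (ω : Ω) : HasDerivAt (fun y => φ y ω) (deriv (fun y => φ y ω) x) x :=
  (((hφ.diffeo ω).2.1 x hx).differentiableAt (hI.mem_nhds hx)).hasDerivAt

/-- A Carathéodory argument on `I`: continuity in `x` and measurability in `ω` give joint
measurability. -/
lemma IsAdmissible.measurable_baseMap (hφ : IsAdmissible P I φ) (hI : IsOpen I) :
    Measurable (Function.uncurry (baseMap I φ)) := by
  have hs : MeasurableSet (Prod.fst ⁻¹' I : Set (ℝ × Ω)) := measurable_fst hI.measurableSet
  refine measurable_of_restrict_of_restrict_compl hs ?_ ?_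
  · have hu : Measurable (Function.uncurry fun (i : I) ω => φ i ω) :=
      measurable_uncurry_of_continuous_of_measurable
        (fun ω => continuousOn_iff_continuous_domRestrict.1 (hφ.diffeo ω).2.1.continuousOn)
        (fun i => hφ.measurable i i.2)
    have hg : Measurable fun p : (Prod.fst ⁻¹' I : Set (ℝ × Ω)) =>
        ((⟨p.1.1, p.2⟩ : I), p.1.2) :=
      ((measurable_fst.comp measurable_subtype_coe).subtype_mk).prodMk
        (measurable_snd.comp measurable_subtype_coe)
    convert hu.comp hg using 1
    funext p
    exact baseMap_of_mem p.2 _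
  · have hg : Measurable fun p : ((Prod.fst ⁻¹' I)ᶜ : Set (ℝ × Ω)) => p.1.1 :=
      measurable_fst.comp measurable_subtype_coe
    convert hg using 1
    funext p
    exact baseMap_of_notMem p.2 _

/-- The derivative of `φ` in the first variable, as a function of both, is measurable over `I`. -/
lemma IsAdmissible.measurable_indicator_deriv (hφ : IsAdmissible P I φ) (hI : IsOpen I) :
    Measurable ((Prod.fst ⁻¹' I).indicator
      fun p : ℝ × Ω => deriv (fun y => φ y p.2) p.1) := by
  have hm := hφ.measurable_baseMap hI
  have hs : MeasurableSet (Prod.fst ⁻¹' I : Set (ℝ × Ω)) := measurable_fst hI.measurableSet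
  -- Forward difference quotients with step `1 / (n + 1)`. The shifted point may leave `I` for small
  -- `n`, which is harmless in the limit because `I` is open.
  let q : ℕ → ℝ × Ω → ℝ := fun n => (Prod.fst ⁻¹' I).indicator fun p =>
    ((1 : ℝ) / (n + 1))⁻¹ * (baseMap I φ (p.1 + 1 / (n + 1)) p.2 - baseMap I φ p.1 p.2)
  refine measurable_of_tendsto_metrizable (f := q) (fun n => ?_) ?_
  · refine Measurable.indicator ?_ hs
    refine Measurable.const_mul (Measurable.sub ?_ hm) _
    exact hm.comp ((measurable_fst.add_const _).prodMk measurable_snd)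
  · rw [tendsto_pi_nhds]
    rintro ⟨x, ω⟩
    by_cases hx : x ∈ I
    · have hd : HasDerivAt (fun y => baseMap I φ y ω) (deriv (fun y => φ y ω) x) x := by
        refine (hφ.hasDerivAt hI hx ω).congr_of_eventuallyEq ?_
        filter_upwards [hI.mem_nhds hx] with y hy
        exact baseMap_of_mem hy ω
      have ht : Tendsto (fun n : ℕ => (1 : ℝ) / (n + 1)) atTop (𝓝[>] 0) :=
        tendsto_nhdsWithin_iff.2 ⟨tendsto_one_div_add_atTop_nhds_zero_nat,
          Eventually.of_forall fun n => by
            show (0 : ℝ) < 1 / (n + 1)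
            positivity⟩
      simpa [q, hx, Function.comp_def] using hd.tendsto_slope_zero_right.comp ht
    · simp [q, hx]

lemma IsAdmissible.measurable_deriv (hφ : IsAdmissible P I φ) (hI : IsOpen I) {x : ℝ}
    (hx : x ∈ I) : Measurable fun ω => deriv (fun y => φ y ω) x := by
  have := (hφ.measurable_indicator_deriv hI).comp (measurable_prodMk_left (x := x))
  simpa [Function.comp_def, indicator_of_mem, hx] using this

lemma IsAdmissible.measurableSet_omegaPlus (hφ : IsAdmissible P I φ) (hI : IsOpen I) {x : ℝ}
    (hx : x ∈ I) : MeasurableSet (omegaPlus φ x) :=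
  measurableSet_lt measurable_const (hφ.measurable_deriv hI hx)

lemma IsAdmissible.ae_mem_omegaPlus [IsProbabilityMeasure P] (hφ : IsAdmissible P I φ)
    (hI : IsOpen I) {x : ℝ} (hx : x ∈ I) (hΩ : P (omegaPlus φ x) = 1) :
    ∀ᵐ ω ∂P, ω ∈ omegaPlus φ x :=
  (mem_ae_iff_prob_eq_one (hφ.measurableSet_omegaPlus hI hx)).2 hΩ

variable {x₀ : ℝ}

lemma IsAdmissible.strictMonoOn (hφ : IsAdmissible P I φ) (hI : IsOpen I) (hc : I.OrdConnected)
    (hx₀ : x₀ ∈ I) {ω : Ω} (hω : ω ∈ omegaPlus φ x₀) : StrictMonoOn (fun x => φ x ω) I :=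
  (hφ.diffeo ω).strictMonoOn hI hc hx₀ hω

lemma IsAdmissible.tendsto_endpoint (hφ : IsAdmissible P I φ) (hI : IsOpen I)
    (hc : I.OrdConnected) (hx₀ : x₀ ∈ I) {ω : Ω} (hω : ω ∈ omegaPlus φ x₀) {x : ℝ}
    (hx : x ∈ closure I) : Tendsto (fun y => φ y ω) (𝓝[I] x) (𝓝 (baseMap I φ x ω)) := by
  by_cases hxI : x ∈ I
  · rw [baseMap_of_mem hxI]
    exact (hφ.diffeo ω).2.1.continuousOn x hxI
  · rw [baseMap_of_notMem hxI]
    exact tendsto_endpoint_of_strictMonoOn (hφ.diffeo ω).1 (hφ.strictMonoOn hI hc hx₀ hω) hc hx hxI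

lemma IsAdmissible.extendClosure_eq (hφ : IsAdmissible P I φ) (hI : IsOpen I)
    (hc : I.OrdConnected) (hx₀ : x₀ ∈ I) {ω : Ω} (hω : ω ∈ omegaPlus φ x₀) {x : ℝ}
    (hx : x ∈ closure I) : extendClosure I φ x ω = baseMap I φ x ω := by
  have ht := hφ.tendsto_endpoint hI hc hx₀ hω hx
  have := mem_closure_iff_nhdsWithin_neBot.1 hx
  unfold extendClosure
  split_ifs with h1 h2
  · exact (baseMap_of_mem h1 ω).symm
  · exact ht.limUnder_eq
  · exact absurd ⟨_, ht⟩ h2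

lemma IsAdmissible.meanContraction [IsProbabilityMeasure P] (hφ : IsAdmissible P I φ)
    (hI : IsOpen I) (hc : I.OrdConnected) (hx₀ : x₀ ∈ I) (hΩ : P (omegaPlus φ x₀) = 1)
    {l : ℝ} (hl0 : 0 < l) (hl1 : l < 1)
    (hcontr : ∀ x ∈ I, ∀ y ∈ I,
      ∫⁻ ω, ENNReal.ofReal |φ x ω - φ y ω| ∂P ≤ ENNReal.ofReal (l * |x - y|))
    (hmoment : ∀ x ∈ I, ∫⁻ ω, ENNReal.ofReal |φ x ω - x| ∂P < ⊤) :
    MeanContraction P (closure I) l (baseMap I φ) where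
  measurable := hφ.measurable_baseMap hI
  mapsTo _ hx ω := hφ.baseMap_mem_closure hx ω
  contr x hx y hy := by
    obtain ⟨u, hu, hux⟩ := mem_closure_iff_seq_limit.1 hx
    obtain ⟨v, hv, hvy⟩ := mem_closure_iff_seq_limit.1 hy
    -- Approximating from inside `I` writes the integrand almost surely as a limit, so Fatou carries
    -- the contraction bound to the closure.
    have hlim : ∀ᵐ ω ∂P, ENNReal.ofReal |baseMap I φ x ω - baseMap I φ y ω| =
        liminf (fun n => ENNReal.ofReal |φ (u n) ω - φ (v n) ω|) atTop := by
      filter_upwards [hφ.ae_mem_omegaPlus hI hx₀ hΩ] with ω hω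
      have h1 := (hφ.tendsto_endpoint hI hc hx₀ hω hx).comp
        (tendsto_nhdsWithin_iff.2 ⟨hux, Eventually.of_forall hu⟩)
      have h2 := (hφ.tendsto_endpoint hI hc hx₀ hω hy).comp
        (tendsto_nhdsWithin_iff.2 ⟨hvy, Eventually.of_forall hv⟩)
      exact (ENNReal.tendsto_ofReal (h1.sub h2).abs).liminf_eq.symm
    rw [lintegral_congr_ae hlim]
    refine (lintegral_liminf_le fun n => ?_).trans ?_
    · exact ((hφ.measurable _ (hu n)).sub (hφ.measurable _ (hv n))).abs.ennreal_ofReal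
    · have ht : Tendsto (fun n => ENNReal.ofReal (l * |u n - v n|)) atTop
          (𝓝 (ENNReal.ofReal (l * |x - y|))) :=
        ENNReal.tendsto_ofReal ((hux.sub hvy).abs.const_mul l)
      rw [← ht.liminf_eq]
      exact liminf_le_liminf (Eventually.of_forall fun n => hcontr _ (hu n) _ (hv n))
  moment x hx := by
    by_cases h : x ∈ I
    · simpa [baseMap_of_mem h] using hmoment x h
    · simp [baseMap_of_notMem h]
  pos := hl0
  lt_one := hl1

lemma IsAdmissible.rvIter_extendClosure_ae_eq [IsProbabilityMeasure P] (hφ : IsAdmissible P I φ)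
    (hI : IsOpen I) (hc : I.OrdConnected) (hx₀ : x₀ ∈ I) (hΩ : P (omegaPlus φ x₀) = 1)
    {x : ℝ} (hx : x ∈ closure I) (n : ℕ) :
    rvIter (baseMap I φ) n x =ᵐ[Measure.infinitePi fun _ : ℕ => P]
      rvIter (extendClosure I φ) n x := by
  have hall : ∀ᵐ ϖ ∂Measure.infinitePi (fun _ : ℕ => P), ∀ i, ϖ i ∈ omegaPlus φ x₀ := by
    refine ae_all_iff.2 fun i => ?_
    exact (measurePreserving_eval_infinitePi (fun _ : ℕ => P) i).quasiMeasurePreserving.ae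
      (hφ.ae_mem_omegaPlus hI hx₀ hΩ)
  filter_upwards [hall] with ϖ hϖ
  induction n with
  | zero => rfl
  | succ n ih =>
    simp only [rvIter]
    rw [← ih, hφ.extendClosure_eq hI hc hx₀ (hϖ n) (rvIter_mem (fun _ => hφ.baseMap_mem_closure) hx n ϖ)]

/-- `IsLimitLaw` expressed through the laws of the iterates of `baseMap`. -/
lemma IsAdmissible.isLimitLaw_iff [IsProbabilityMeasure P] (hφ : IsAdmissible P I φ)
    (hI : IsOpen I) (hc : I.OrdConnected) (hx₀ : x₀ ∈ I) (hΩ : P (omegaPlus φ x₀) = 1)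
    (π : ProbabilityMeasure ℝ) :
    IsLimitLaw P I φ π ↔ (π : Measure ℝ) (closure I)ᶜ = 0 ∧ ∀ x ∈ closure I,
      Tendsto (β := ProbabilityMeasure ℝ) (fun n => ⟨iterLaw P (baseMap I φ) n x,
        isProbabilityMeasure_iterLaw P (hφ.measurable_baseMap hI) n x⟩) atTop (𝓝 π) := by
  refine and_congr_right fun _ => forall₂_congr fun x hx => ?_
  have hcongr := hφ.rvIter_extendClosure_ae_eq hI hc hx₀ hΩ hx
  have hid : (⟨(π : Measure ℝ).map id, Measure.isProbabilityMeasure_map aemeasurable_id⟩ :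
      ProbabilityMeasure ℝ) = π := Subtype.ext Measure.map_id
  constructor
  · intro h
    have h' := (h.congr (fun n => (hcongr n).symm) (ae_eq_refl _)).tendsto
    rwa [hid] at h'
  · intro h
    refine TendstoInDistribution.congr (X := fun n => rvIter (baseMap I φ) n x) hcongr
      (ae_eq_refl _) ⟨fun n => (measurable_rvIter (hφ.measurable_baseMap hI) x n).aemeasurable,
        aemeasurable_id, ?_⟩
    rw [hid]
    exact h

theorem IsAdmissible.existsUnique_isLimitLaw [IsProbabilityMeasure P] (hφ : IsAdmissible P I φ)
    (hI : IsOpen I) (hc : I.OrdConnected) (hx₀ : x₀ ∈ I) (hΩ : P (omegaPlus φ x₀) = 1)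
    {l : ℝ} (H : MeanContraction P (closure I) l (baseMap I φ)) :
    ∃! π : ProbabilityMeasure ℝ, IsLimitLaw P I φ π := by
  simp only [hφ.isLimitLaw_iff hI hc hx₀ hΩ]
  obtain ⟨π, h1, h2⟩ := H.exists_limitLaw isClosed_closure ⟨x₀, subset_closure hx₀⟩
  exact ⟨π, ⟨h1, h2⟩, fun π' h' => tendsto_nhds_unique (h'.2 x₀ (subset_closure hx₀))
    (h2 x₀ (subset_closure hx₀))⟩

end BaseMap

/-! ### Primitives of integrable functions and their means -/

section Primitive

variable {I : Set ℝ} {g : ℝ → ℝ}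

lemma primitive_eq_indicator (hI : MeasurableSet I) (g : ℝ → ℝ) (x : ℝ) :
    primitive I g x = ∫ t in Iic x, I.indicator g t := by
  rw [setIntegral_indicator hI, inter_comm, primitive]

lemma primitive_sub_indicator (hI : MeasurableSet I) (hg : IntegrableOn g I) (x y : ℝ) :
    primitive I g y - primitive I g x = ∫ t in x..y, I.indicator g t := by
  have hi := (integrable_indicator_iff hI).2 hg
  rw [primitive_eq_indicator hI, primitive_eq_indicator hI,
    intervalIntegral.integral_Iic_sub_Iic hi.integrableOn hi.integrableOn]

lemma integral_indicator_of_mem (hc : I.OrdConnected) {x y : ℝ} (hx : x ∈ I) (hy : y ∈ I) :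
    ∫ t in x..y, I.indicator g t = ∫ t in x..y, g t :=
  intervalIntegral.integral_congr fun _ ht => indicator_of_mem (hc.uIcc_subset hx hy ht) _

lemma primitive_sub (hI : MeasurableSet I) (hc : I.OrdConnected) (hg : IntegrableOn g I)
    {x y : ℝ} (hx : x ∈ I) (hy : y ∈ I) :
    primitive I g y - primitive I g x = ∫ t in x..y, g t := by
  rw [primitive_sub_indicator hI hg, integral_indicator_of_mem hc hx hy]

lemma continuous_primitive (hI : MeasurableSet I) (hg : IntegrableOn g I) :
    Continuous (primitive I g) := by
  have hi := (integrable_indicator_iff hI).2 hg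
  have h : primitive I g = fun x => primitive I g 0 + ∫ t in (0 : ℝ)..x, I.indicator g t := by
    funext x
    rw [← primitive_sub_indicator hI hg]
    ring
  rw [h]
  exact continuous_const.add
    (intervalIntegral.continuous_primitive (fun _ _ => hi.intervalIntegrable) 0)

lemma abs_primitive_le (hg : IntegrableOn g I) (x : ℝ) :
    |primitive I g x| ≤ ∫ t in I, |g t| :=
  abs_integral_le_integral_abs.trans (setIntegral_mono_set hg.abs
    (ae_of_all _ fun _ => abs_nonneg _) (LE.le.eventuallyLE inter_subset_left))

lemma primitive_congr {f : ℝ → ℝ} (h : f =ᵐ[volume.restrict I] g) :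
    primitive I f = primitive I g := by
  funext x
  exact integral_congr_ae (ae_restrict_of_ae_restrict_of_subset inter_subset_left h)

/-- The mean of the primitive of `g` under a law `π`. -/
lemma integral_primitive (hg : IntegrableOn g I) (π : Measure ℝ)
    [IsProbabilityMeasure π] :
    ∫ x, primitive I g x ∂π = ∫ t in I, g t * (1 - cdf π t) := by
  -- With the strict inequality the section at `t` is `Ioi t`, of mass exactly `1 - cdf π t` even if
  -- `π` has atoms; in the variable `t` the endpoint is Lebesgue-null.
  have hset : MeasurableSet {p : ℝ × ℝ | p.2 < p.1} :=
    measurableSet_lt measurable_snd measurable_fst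
  have hint : Integrable ({p : ℝ × ℝ | p.2 < p.1}.indicator fun p => g p.2)
      (π.prod (volume.restrict I)) := (hg.integrable.comp_snd π).indicator hset
  have h1 : ∀ x, primitive I g x = ∫ t in I, {p : ℝ × ℝ | p.2 < p.1}.indicator
      (fun p => g p.2) (x, t) := by
    intro x
    have : (fun t => {p : ℝ × ℝ | p.2 < p.1}.indicator (fun p => g p.2) (x, t))
        = (Iio x).indicator g := by
      funext t
      simp [indicator_apply]
    rw [this, setIntegral_indicator measurableSet_Iio, primitive]
    exact setIntegral_congr_set ((ae_eq_refl I).inter Iio_ae_eq_Iic.symm)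
  simp_rw [h1]
  rw [integral_integral_swap (f := fun x t => {p : ℝ × ℝ | p.2 < p.1}.indicator
    (fun p => g p.2) (x, t)) hint]
  congr 1
  funext t
  have h2 : (fun x => {p : ℝ × ℝ | p.2 < p.1}.indicator (fun p => g p.2) (x, t))
      = (Ioi t).indicator fun _ => g t := by
    funext x
    simp [indicator_apply]
  rw [h2, integral_indicator_const _ measurableSet_Ioi, cdf_eq_real, smul_eq_mul, mul_comm,
    ← compl_Iic, probReal_compl_eq_one_sub measurableSet_Iic]

end Primitive

/-! ### The Neumann series of the Markov operator -/

section Neumann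

variable {Ω : Type*} [MeasurableSpace Ω] {P : Measure Ω} [IsProbabilityMeasure P] {J : Set ℝ}
  {l K : ℝ} {ψ : ℝ → Ω → ℝ} {G : ℝ → ℝ}

/-- If the iterates of the Markov operator send a Lipschitz function `G` to zero, then the series of
these iterates is a Lipschitz solution of `F = T F + G`. -/
theorem BddLipOn.exists_lipschitz_solution (hK : 0 ≤ K) (H : MeanContraction P J l ψ)
    (hG : BddLipOn J K G) (hlim : ∀ x ∈ J, Tendsto (fun n => (markovOp P ψ)^[n] G x) atTop (𝓝 0)) :
    ∃ F : ℝ → ℝ, (∀ x ∈ J, ∀ y ∈ J, |F x - F y| ≤ K / (1 - l) * |x - y|) ∧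
      ∀ x ∈ J, Integrable (fun ω => F (ψ x ω)) P ∧ F x = ∫ ω, F (ψ x ω) ∂P + G x := by
  set T := fun n : ℕ => (markovOp P ψ)^[n] G with hT
  have hTl : ∀ n, BddLipOn J (K * l ^ n) (T n) := fun n => hG.map_markovOp_iterate hK H n
  have hgeo : HasSum (fun n : ℕ => l ^ n) (1 - l)⁻¹ := hasSum_geometric_of_lt_one H.pos.le H.lt_one
  have hl := sub_pos.2 H.lt_one
  -- Geometric tail at `x` plus the Lipschitz bound from `x` to `y`. The growth in `y` is linear, so
  -- it stays integrable along `y = ψ x ω` and permits exchanging sum and integral.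
  have hbound : ∀ x ∈ J, ∃ C, 0 ≤ C ∧ ∀ y ∈ J, ∀ n, |T n y| ≤ (C + K * |y - x|) * l ^ n := by
    intro x hx
    have hM : 0 ≤ ∫ ω, |ψ x ω - x| ∂P := integral_nonneg fun _ => abs_nonneg _
    refine ⟨K * (∫ ω, |ψ x ω - x| ∂P) / (1 - l), by positivity, fun y hy n => ?_⟩
    have h1 := dist_le_of_le_geometric_of_tendsto l _ H.lt_one
      (hG.dist_markovOp_iterate_le hK H hx) (hlim x hx) n
    rw [Real.dist_eq, sub_zero] at h1
    have h2 := (hTl n).lip y hy x hx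
    have h3 := abs_add_le (T n y - T n x) (T n x)
    rw [sub_add_cancel] at h3
    calc |T n y| ≤ _ := h3
      _ ≤ K * l ^ n * |y - x| + K * (∫ ω, |ψ x ω - x| ∂P) * l ^ n / (1 - l) := add_le_add h2 h1
      _ = _ := by ring
  have hsum : ∀ y ∈ J, Summable fun n => T n y := by
    intro y hy
    obtain ⟨C, -, hC⟩ := hbound y hy
    exact Summable.of_norm_bounded (hgeo.summable.mul_left (C + K * |y - y|)) fun n => hC y hy n
  set F : ℝ → ℝ := fun y => ∑' n, T n y with hF
  have hFlip : ∀ x ∈ J, ∀ y ∈ J, |F x - F y| ≤ K / (1 - l) * |x - y| := by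
    intro x hx y hy
    simp only [hF]
    rw [← (hsum x hx).tsum_sub (hsum y hy)]
    have h := tsum_of_norm_bounded (f := fun n => T n x - T n y)
      ((hgeo.mul_left K).mul_right |x - y|) (fun n => (hTl n).lip x hx y hy)
    simpa [div_eq_mul_inv] using h
  refine ⟨F, hFlip, fun x hx => ?_⟩
  obtain ⟨C, hC0, hC⟩ := hbound x hx
  have hTint : ∀ n, Integrable (fun ω => T n (ψ x ω)) P := fun n => (hTl n).integrable_comp H x
  have hdom : Integrable (fun ω => C + K * |ψ x ω - x|) P :=
    (integrable_const C).add ((H.integrable_disp hx).const_mul K)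
  have hnorm : Summable fun n => ∫ ω, ‖T n (ψ x ω)‖ ∂P := by
    refine Summable.of_nonneg_of_le (fun n => integral_nonneg fun _ => norm_nonneg _) (fun n => ?_)
      (hgeo.summable.mul_left (∫ ω, (C + K * |ψ x ω - x|) ∂P))
    rw [← integral_mul_const]
    exact integral_mono (hTint n).norm (hdom.mul_const _) fun ω => hC _ (H.mapsTo x hx ω) n
  have hmain := hasSum_integral_of_summable_integral_norm hTint hnorm
  have hmeas : AEStronglyMeasurable (fun ω => F (ψ x ω)) P := by
    refine aestronglyMeasurable_of_tendsto_ae atTop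
      (f := fun (n : ℕ) ω => ∑ i ∈ Finset.range n, T i (ψ x ω)) (fun n => ?_)
      (ae_of_all _ fun ω => (hsum _ (H.mapsTo x hx ω)).hasSum.tendsto_sum_nat)
    exact (integrable_finsetSum _ fun i _ => hTint i).1
  refine ⟨?_, ?_⟩
  · refine Integrable.mono' ((integrable_const |F x|).add
      ((H.integrable_disp hx).const_mul (K / (1 - l)))) hmeas (ae_of_all _ fun ω => ?_)
    have h1 := hFlip _ (H.mapsTo x hx ω) x hx
    have h2 := abs_add_le (F (ψ x ω) - F x) (F x)
    rw [sub_add_cancel] at h2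
    simp only [Real.norm_eq_abs, Pi.add_apply]
    linarith
  · have hstep : ∀ n, ∫ ω, T n (ψ x ω) ∂P = T (n + 1) x := fun n => by
      simp only [hT, Function.iterate_succ_apply']
      rfl
    simp only [hstep] at hmain
    have h0 := (hsum x hx).tsum_eq_zero_add
    rw [hmain.tsum_eq] at h0
    rw [add_comm]
    exact h0

end Neumann

/-! ### An absolutely continuous solution of the primitive equation -/

section Solution

lemma absContOn_of_lipschitz {F : ℝ → ℝ} {I : Set ℝ} {C : ℝ} (hC : 0 ≤ C)
    (h : ∀ x ∈ I, ∀ y ∈ I, |F x - F y| ≤ C * |x - y|) : AbsContOn F I := by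
  intro ε hε
  refine ⟨ε / (C + 1), by positivity, fun n a b hab _ hsum => ?_⟩
  have h1 : ∑ i, |F (b i) - F (a i)| ≤ C * ∑ i, (b i - a i) := by
    rw [Finset.mul_sum]
    refine Finset.sum_le_sum fun i _ => ?_
    obtain ⟨ha, hb, hle⟩ := hab i
    simpa [abs_of_nonneg (sub_nonneg.2 hle)] using h _ hb _ ha
  have h2 : 0 ≤ ∑ i, (b i - a i) := Finset.sum_nonneg fun i _ => sub_nonneg.2 (hab i).2.2
  rw [lt_div_iff₀ (by positivity)] at hsum
  linarith

variable {Ω : Type*} [MeasurableSpace Ω] {P : Measure Ω} [IsProbabilityMeasure P] {I : Set ℝ}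
  {φ : ℝ → Ω → ℝ} {x₀ : ℝ}

lemma IsAdmissible.measure_omegaMinus (hφ : IsAdmissible P I φ) (hI : IsOpen I) (hx₀ : x₀ ∈ I)
    (hΩ : P (omegaPlus φ x₀) = 1) : P (omegaMinus φ x₀) = 0 :=
  measure_mono_null (t := (omegaPlus φ x₀)ᶜ)
    (fun _ (hω : _ < (0 : ℝ)) (hω' : (0 : ℝ) < _) => lt_asymm hω hω') (hφ.ae_mem_omegaPlus hI hx₀ hΩ)

/-- When `P(Ω₊) = 1` the equation for primitives does not involve `α`. -/
lemma IsAdmissible.solvesPrimitiveEq_iff (hφ : IsAdmissible P I φ) (hI : IsOpen I) (hx₀ : x₀ ∈ I)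
    (hΩ : P (omegaPlus φ x₀) = 1) {g F : ℝ → ℝ} {α : ℝ} :
    SolvesPrimitiveEq P I φ g x₀ α F ↔ ∀ x ∈ I, Integrable (fun ω => F (φ x ω)) P ∧
      F x = ∫ ω, F (φ x ω) ∂P + primitive I g x := by
  have h1 : P.restrict (omegaPlus φ x₀) = P :=
    Measure.restrict_eq_self_of_ae_mem (hφ.ae_mem_omegaPlus hI hx₀ hΩ)
  have h2 : P.restrict (omegaMinus φ x₀) = 0 :=
    Measure.restrict_eq_zero.2 (hφ.measure_omegaMinus hI hx₀ hΩ)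
  simp [SolvesPrimitiveEq, IntegrableOn, h1, h2]

theorem IsAdmissible.exists_absContOn_solution (hφ : IsAdmissible P I φ) (hI : IsOpen I)
    (hc : I.OrdConnected) (hx₀ : x₀ ∈ I) (hΩ : P (omegaPlus φ x₀) = 1) {l : ℝ}
    (H : MeanContraction P (closure I) l (baseMap I φ)) {g : ℝ → ℝ} (hg : IntegrableOn g I)
    {π : ProbabilityMeasure ℝ} (hπ : IsLimitLaw P I φ π)
    (hmean : ∫ t in I, g t * (1 - cdf (π : Measure ℝ) t) = 0) {L : ℝ} (hL : 0 < L)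
    (hlip : ∀ x ∈ I, ∀ y ∈ I, |∫ t in x..y, g t| ≤ L * |x - y|) :
    ∃ F : ℝ → ℝ, AbsContOn F I ∧ ∀ α : ℝ, SolvesPrimitiveEq P I φ g x₀ α F := by
  -- The Lipschitz bound on the primitive is available on `I` only, so the contraction is restricted
  -- back from the closure.
  have hmono : MeanContraction P I l (baseMap I φ) :=
    { H with
      mapsTo := fun x hx ω => by simpa [baseMap_of_mem hx] using hφ.mem hx ω
      contr := fun x hx y hy => H.contr x (subset_closure hx) y (subset_closure hy)
      moment := fun x hx => H.moment x (subset_closure hx) }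
  have hcont := continuous_primitive hI.measurableSet hg
  have hG : BddLipOn I L (primitive I g) := by
    refine ⟨hcont.measurable, fun x hx y hy => ?_, _, abs_primitive_le hg⟩
    rw [primitive_sub hI.measurableSet hc hg hy hx, abs_sub_comm]
    exact hlip y hy x hx
  have hlim : ∀ x ∈ I, Tendsto (fun n => (markovOp P (baseMap I φ))^[n] (primitive I g) x) atTop
      (𝓝 0) := by
    intro x hx
    have hw := ((hφ.isLimitLaw_iff hI hc hx₀ hΩ π).1 hπ).2 x (subset_closure hx)
    have ht := ProbabilityMeasure.tendsto_iff_forall_integral_tendsto.1 hw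
      (BoundedContinuousFunction.ofNormedAddCommGroup (primitive I g) hcont _ (abs_primitive_le hg))
    have h0 : ∫ x, primitive I g x ∂(π : Measure ℝ) = 0 := by
      rw [integral_primitive hg, hmean]
    simp only [BoundedContinuousFunction.coe_ofNormedAddCommGroup, h0] at ht
    exact ht.congr fun n => hG.integral_iterLaw hL.le hmono n x
  obtain ⟨F, hF1, hF2⟩ := hG.exists_lipschitz_solution hL.le hmono hlim
  refine ⟨F, absContOn_of_lipschitz (div_nonneg hL.le (sub_pos.2 H.lt_one).le) hF1, fun α => ?_⟩
  rw [hφ.solvesPrimitiveEq_iff hI hx₀ hΩ]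
  intro x hx
  simpa only [baseMap_of_mem hx] using hF2 x hx

end Solution

/-! ### Recovering a function from its integrals over intervals -/

section Differentiation

/-- An integrable function on an open interval is determined almost everywhere by its integrals
over subintervals. -/
lemma ae_eq_zero_of_forall_intervalIntegral_eq_zero {I : Set ℝ} (hI : IsOpen I)
    (hc : I.OrdConnected) {u : ℝ → ℝ} (hu : IntegrableOn u I)
    (h : ∀ x ∈ I, ∀ y ∈ I, x ≤ y → ∫ t in Ioc x y, u t = 0) :
    u =ᵐ[volume.restrict I] 0 := by
  have hi := (integrable_indicator_iff hI.measurableSet).2 hu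
  refine (ae_restrict_iff' hI.measurableSet).2 ?_
  filter_upwards [LocallyIntegrable.ae_hasDerivAt_integral hi.locallyIntegrable] with x hx hxI
  have h0 : (fun y => ∫ t in x..y, I.indicator u t) =ᶠ[𝓝 x] fun _ => 0 := by
    filter_upwards [hI.mem_nhds hxI] with y hy
    rw [integral_indicator_of_mem hc hxI hy]
    rcases le_total x y with hxy | hxy
    · rw [intervalIntegral.integral_of_le hxy, h x hxI y hy hxy]
    · rw [intervalIntegral.integral_of_ge hxy, h y hy x hxI hxy, neg_zero]
  have h1 := (hx x).unique ((hasDerivAt_const x (0 : ℝ)).congr_of_eventuallyEq h0)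
  simpa [hxI] using h1

end Differentiation

/-! ### From the primitive equation back to the original one -/

section Density

variable {Ω : Type*} [MeasurableSpace Ω] {P : Measure Ω} {I : Set ℝ}
  {φ : ℝ → Ω → ℝ} {x₀ : ℝ} {f : ℝ → ℝ}

/-- Change of variables along the increasing map `φ(·, ω)`, which carries `Ioc x y` onto `Ioc (φ x
ω) (φ y ω)`. -/
lemma IsAdmissible.integral_Ioc_density (hφ : IsAdmissible P I φ) (hI : IsOpen I)
    (hc : I.OrdConnected) (hx₀ : x₀ ∈ I) {ω : Ω} (hω : ω ∈ omegaPlus φ x₀)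
    (hf : IntegrableOn f I) {x y : ℝ} (hx : x ∈ I) (hy : y ∈ I) (hxy : x ≤ y) :
    ∫ t in Ioc x y, |deriv (fun y => φ y ω) t| * f (φ t ω)
      = primitive I f (φ y ω) - primitive I f (φ x ω) := by
  have hm := hφ.strictMonoOn hI hc hx₀ hω
  have hsub : Ioc x y ⊆ I := Ioc_subset_Icc_self.trans (hc.out hx hy)
  have himg : (fun t => φ t ω) '' Ioc x y = Ioc (φ x ω) (φ y ω) := by
    ext z
    constructor
    · rintro ⟨t, ht, rfl⟩
      exact ⟨hm hx (hsub ht) ht.1, hm.monotoneOn (hsub ht) hy ht.2⟩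
    · intro hz
      obtain ⟨t, ht, rfl⟩ := (hφ.diffeo ω).1.surjOn
        (hc.out (hφ.mem hx ω) (hφ.mem hy ω) (Ioc_subset_Icc_self hz))
      exact ⟨t, ⟨(hm.lt_iff_lt hx ht).1 hz.1, (hm.le_iff_le ht hy).1 hz.2⟩, rfl⟩
  have h := integral_image_eq_integral_abs_deriv_smul (s := Ioc x y) measurableSet_Ioc
    (fun t ht => (hφ.hasDerivAt hI (hsub ht) ω).hasDerivWithinAt)
    ((hφ.diffeo ω).1.injOn.mono hsub) f
  rw [primitive_sub hI.measurableSet hc hf (hφ.mem hx ω) (hφ.mem hy ω),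
    intervalIntegral.integral_of_le (hm.monotoneOn hx hy hxy), ← himg, h]
  simp only [smul_eq_mul]

variable [IsProbabilityMeasure P]

lemma IsAdmissible.aestronglyMeasurable_density (hφ : IsAdmissible P I φ) (hI : IsOpen I)
    (hf : IntegrableOn f I) :
    AEStronglyMeasurable (fun p : ℝ × Ω => |deriv (fun y => φ y p.2) p.1| * f (φ p.1 p.2))
      ((volume.restrict I).prod P) := by
  have hs : MeasurableSet (Prod.fst ⁻¹' I : Set (ℝ × Ω)) := measurable_fst hI.measurableSet
  have hres : (volume.restrict I).prod P = (volume.prod P).restrict (Prod.fst ⁻¹' I) := by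
    rw [← prod_univ, ← Measure.prod_restrict, Measure.restrict_univ]
  set f₁ := hf.1.mk f with hf₁
  have hm : Measurable f₁ := hf.1.stronglyMeasurable_mk.measurable
  have hae : ∀ᵐ t ∂volume, t ∈ I → f t = f₁ t :=
    (ae_restrict_iff' hI.measurableSet).1 hf.1.ae_eq_mk
  -- `f` is replaced by a measurable version off the null set `B`; the nonsingularity condition
  -- `null_preimage` makes this replacement valid after composing with `φ`.
  obtain ⟨B, hBsub, hBm, hB0⟩ := exists_measurable_superset_of_null hae
  have hnull := hφ.null_preimage (B ∩ I) (hBm.inter hI.measurableSet) inter_subset_right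
    (measure_mono_null inter_subset_left hB0)
  refine ⟨fun p => |(Prod.fst ⁻¹' I).indicator (fun p : ℝ × Ω => deriv (fun y => φ y p.2) p.1) p| *
    f₁ (baseMap I φ p.1 p.2), ?_, ?_⟩
  · exact ((hφ.measurable_indicator_deriv hI).abs.mul
      (hm.comp (hφ.measurable_baseMap hI))).stronglyMeasurable
  · rw [hres]
    refine (ae_restrict_iff' hs).2 ?_
    have hne : ∀ᵐ p ∂(volume : Measure ℝ).prod P,
        p ∉ {p : ℝ × Ω | p.1 ∈ I ∧ φ p.1 p.2 ∈ B ∩ I} := measure_eq_zero_iff_ae_notMem.1 hnull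
    filter_upwards [hne] with p hp hpI
    have hpI' : p.1 ∈ I := hpI
    have hmem := hφ.mem hpI' p.2
    have hfe : f (φ p.1 p.2) = f₁ (φ p.1 p.2) := by
      by_contra hcon
      exact hp ⟨hpI', hBsub fun h => hcon (h hmem), hmem⟩
    rw [indicator_of_mem hpI, baseMap_of_mem hpI', hfe]

/-- Since `φ(·, ω)` maps `I` bijectively onto `I`, the `L¹` norm in `x` equals that of `f` for every
`ω`, hence is integrable over the probability space. -/
lemma IsAdmissible.integrable_density (hφ : IsAdmissible P I φ) (hI : IsOpen I)
    (hf : IntegrableOn f I) :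
    Integrable (fun p : ℝ × Ω => |deriv (fun y => φ y p.2) p.1| * f (φ p.1 p.2))
      ((volume.restrict I).prod P) := by
  have hder : ∀ ω, ∀ x ∈ I,
      HasDerivWithinAt (fun y => φ y ω) (deriv (fun y => φ y ω) x) I x :=
    fun ω x hx => (hφ.hasDerivAt hI hx ω).hasDerivWithinAt
  refine (integrable_prod_iff' (hφ.aestronglyMeasurable_density hI hf)).2
    ⟨ae_of_all _ fun ω => ?_, ?_⟩
  · have := integrableOn_image_iff_integrableOn_abs_deriv_smul hI.measurableSet (hder ω)
      (hφ.diffeo ω).1.injOn f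
    rw [(hφ.diffeo ω).1.image_eq] at this
    exact this.1 hf
  · have hconst : (fun ω => ∫ x in I, ‖|deriv (fun y => φ y ω) x| * f (φ x ω)‖)
        = fun _ => ∫ x in I, |f x| := by
      funext ω
      have := integral_image_eq_integral_abs_deriv_smul hI.measurableSet (hder ω)
        (hφ.diffeo ω).1.injOn fun x => |f x|
      rw [(hφ.diffeo ω).1.image_eq] at this
      simpa [abs_mul] using this.symm
    simp only [hconst]
    exact integrable_const _

/-- The derivative of a solution of the equation for primitives solves the original equation. -/
theorem IsAdmissible.ae_eq_of_primitive_solution (hφ : IsAdmissible P I φ) (hI : IsOpen I)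
    (hc : I.OrdConnected) (hx₀ : x₀ ∈ I) (hΩ : P (omegaPlus φ x₀) = 1) {g : ℝ → ℝ}
    (hg : IntegrableOn g I) (hf : IntegrableOn f I)
    (hsol : ∀ x ∈ I, Integrable (fun ω => primitive I f (φ x ω)) P ∧
      primitive I f x = ∫ ω, primitive I f (φ x ω) ∂P + primitive I g x) :
    ∀ᵐ x ∂(volume.restrict I),
      Integrable (fun ω => |deriv (fun y => φ y ω) x| * f (φ x ω)) P ∧
      f x = (∫ ω, |deriv (fun y => φ y ω) x| * f (φ x ω) ∂P) + g x := by
  have hk := hφ.integrable_density hI hf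
  have hh : IntegrableOn (fun x => ∫ ω, |deriv (fun y => φ y ω) x| * f (φ x ω) ∂P) I :=
    hk.integral_prod_left
  have hzero := ae_eq_zero_of_forall_intervalIntegral_eq_zero hI hc ((hf.sub hh).sub hg) ?_
  · filter_upwards [hk.prod_right_ae, hzero] with x hx1 hx2
    refine ⟨hx1, ?_⟩
    simp only [Pi.sub_apply, Pi.zero_apply] at hx2
    linarith
  intro x hx y hy hxy
  have hsub : Ioc x y ⊆ I := Ioc_subset_Icc_self.trans (hc.out hx hy)
  have hswap : ∫ t in Ioc x y, ∫ ω, |deriv (fun y => φ y ω) t| * f (φ t ω) ∂P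
      = ∫ ω, (primitive I f (φ y ω) - primitive I f (φ x ω)) ∂P := by
    rw [integral_integral_swap (hk.mono_measure
      (Measure.prod_mono (Measure.restrict_mono_set _ hsub) le_rfl))]
    refine integral_congr_ae ?_
    filter_upwards [hφ.ae_mem_omegaPlus hI hx₀ hΩ] with ω hω
    exact hφ.integral_Ioc_density hI hc hx₀ hω hf hx hy hxy
  have hfx := primitive_sub hI.measurableSet hc hf hx hy
  have hgx := primitive_sub hI.measurableSet hc hg hx hy
  rw [intervalIntegral.integral_of_le hxy] at hfx hgx
  rw [integral_sub' ((hf.mono_set hsub).sub (hh.mono_set hsub)) (hg.mono_set hsub),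
    integral_sub' (hf.mono_set hsub) (hh.mono_set hsub), hswap,
    integral_sub (hsol y hy).1 (hsol x hx).1, ← hfx, ← hgx]
  linarith [(hsol x hx).2, (hsol y hy).2]

end Density
end RefinementEq

/-! ### The main theorem -/

open RefinementEq
theorem mainTheorem3 {Ω : Type*} [MeasurableSpace Ω] (P : Measure Ω) [IsProbabilityMeasure P]
    [P.IsComplete]
    (I : Set ℝ) (hI_open : IsOpen I) (hI_interval : I.OrdConnected)
    (φ : ℝ → Ω → ℝ) (hφ : IsAdmissible P I φ)
    (x₀ : ℝ) (hx₀ : x₀ ∈ I) (hΩ : P (omegaPlus φ x₀) = 1)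
    (l : ℝ) (hl0 : 0 < l) (hl1 : l < 1)
    (hcontr : ∀ x ∈ I, ∀ y ∈ I,
      ∫⁻ ω, ENNReal.ofReal |φ x ω - φ y ω| ∂P ≤ ENNReal.ofReal (l * |x - y|))
    (hmoment : ∀ x ∈ I, ∫⁻ ω, ENNReal.ofReal |φ x ω - x| ∂P < ⊤)
    (g : ℝ → ℝ) (hg : IntegrableOn g I) :
    (∃! π : ProbabilityMeasure ℝ, IsLimitLaw P I φ π) ∧
    ∀ π : ProbabilityMeasure ℝ, IsLimitLaw P I φ π →
      ∫ t in I, g t * (1 - cdf (π : Measure ℝ) t) = 0 →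
      (∃ L : ℝ, 0 < L ∧ ∀ x ∈ I, ∀ y ∈ I, |∫ t in x..y, g t| ≤ L * |x - y|) →
      (∃ F : ℝ → ℝ, AbsContOn F I ∧ ∀ α : ℝ, SolvesPrimitiveEq P I φ g x₀ α F) ∧
      (∀ (F : ℝ → ℝ) (α : ℝ), SolvesPrimitiveEq P I φ g x₀ α F →
        ∀ f : ℝ → ℝ, IntegrableOn f I → (∀ x ∈ I, F x = primitive I f x) →
          IsL1Solution P I φ g f) := by
  have H := hφ.meanContraction hI_open hI_interval hx₀ hΩ hl0 hl1 hcontr hmoment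
  refine ⟨hφ.existsUnique_isLimitLaw hI_open hI_interval hx₀ hΩ H, fun π hπ hmean hL => ⟨?_, ?_⟩⟩
  · obtain ⟨L, hL, hlip⟩ := hL
    exact hφ.exists_absContOn_solution hI_open hI_interval hx₀ hΩ H hg hπ hmean hL hlip
  · intro F α hF f hf hFf
    refine ⟨hf, fun f' hf' => ?_⟩
    -- Any representative `f'` has the same primitive as `f`, so the argument applies to `f'`
    -- directly.
    refine hφ.ae_eq_of_primitive_solution hI_open hI_interval hx₀ hΩ hg
      (hf.congr hf'.symm) fun x hx => ?_
    have h := (hφ.solvesPrimitiveEq_iff hI_open hx₀ hΩ).1 hF x hx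
    simpa only [primitive_congr hf', hFf x hx, hFf _ (hφ.mem hx _)] using h
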